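/- **Setting.** Let $d\ge 2$, $k\ge 1$, $m\ge 0$ be integers and let $\sigma, C_{is}>0$. Let $\mathcal K_h$ be a finite conforming mesh of $d$-simplices in $\mathbb R^d$, with $\Omega_h=\bigcup_{K\in\mathcal K_h}K$, which is shape regular and quasi-uniform with mesh parameter $h>0$: every $K$ contains a ball of radius $r_K$ with $\operatorname{diam}K\le\sigma r_K$, and $\sigma^{-1}h\le\operatorname{diam}K\le\sigma h$. The boundary $\partial\Omega_h$ is the union of the $(d-1)$-dimensional faces that belong to exactly one element. Let $V_h^j$ be the space of continuous functions on $\Omega_h$ that are polynomials of degree at most $j$ on each element. Let $V_h$ be a linear space with $V_h^k\subseteq V_h\subseteq V_h^m$ (for instance $V_h^k$ enriched with higher order bubbles on the boundary faces). Let $\Lambda_h$ be the space of functions on $\partial\Omega_h$ that are polynomials of degree at most $k-1$ on each boundary face, with no continuity between faces. Write $(\cdot,\cdot)_M$ and $\|\cdot\|_M$ for the $L^2$ inner product and norm on $M$. For a measurable function $\varrho_h:\partial\Omega_h\to\mathbb R$ (the discrete signed distance to the exact boundary) put $$A(u,\lambda;v,\mu)=(\nabla u,\nabla v)_{\Omega_h}+(\lambda,v)_{\partial\Omega_h}+(u,\mu)_{\partial\Omega_h}-(\varrho_h\lambda,\mu)_{\partial\Omega_h},$$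 $$|||(v,\mu)|||=\|\nabla v\|_{\Omega_h}+\|h^{-1/2}v\|_{\partial\Omega_h}+\|h^{1/2}\mu\|_{\partial\Omega_h}.$$ The pair $V_h\times\Lambda_h$ satisfies the discrete inf–sup condition with constant $C_{is}$ if for every $\eta\in\Lambda_h$ there is $v_\eta\in V_h$ with $$\|h^{1/2}\eta\|_{\partial\Omega_h}^2\le C_{is}\,(\eta,v_\eta)_{\partial\Omega_h},\qquad \|\nabla v_\eta\|_{\Omega_h}+\|h^{-1/2}v_\eta\|_{\partial\Omega_h}\le C_{is}\,\|h^{1/2}\eta\|_{\partial\Omega_h}.$$ **Proposition.** There is a constant $C_{\partial\Omega}>0$, depending only on $d,k,m,\sigma,C_{is}$, such that for every $C_\varrho$ there is a constant $C>0$, depending only on $d,k,m,\sigma,C_{is},C_\varrho$, with the following property. For all meshes, mesh parameters $h$ and spaces $V_h$ as above such that $V_h\times\Lambda_h$ satisfies the discrete inf–sup condition with constant $C_{is}$, and all measurable $\varrho_h$ with $\varrho_h\ge -C_{\partial\Omega}h$ and $|\varrho_h|\le C_\varrho h$ almost everywhere on $\partial\Omega_h$: for every $(y_h,\eta_h)\in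 V_h\times\Lambda_h$ there is $(v_h,\mu_h)\in V_h\times\Lambda_h$ such that $$|||(y_h,\eta_h)|||^2\le C\,A(y_h,\eta_h;v_h,\mu_h)\qquad\text{and}\qquad |||(v_h,\mu_h)|||\le C\,|||(y_h,\eta_h)|||.$$ -/

import Mathlib

open MeasureTheory
open scoped MeasureTheory

noncomputable section

namespace BoundaryCorrection

/-- The Euclidean space `ℝᵈ`. -/
abbrev Pt (d : ℕ) := EuclideanSpace ℝ (Fin d)

/-- The value at the point `x` of the polynomial `p` in `d` variables. -/
def polyVal {d : ℕ} (p : MvPolynomial (Fin d) ℝ) (x : Pt d) : ℝ :=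
  MvPolynomial.eval (fun i => x i) p

/-! ### Meshes

A simplex is given by its set of vertices; the closed simplex itself is the convex hull. -/

/-- `T` triangulates a polyhedral domain in `ℝᵈ`: it is a finite (conforming) simplicial complex
in which every simplex is a face of a `d`-dimensional one. -/
structure IsMesh {d : ℕ} (T : Geometry.SimplicialComplex ℝ (Pt d)) : Prop where
  finite : T.faces.Finite
  pure : ∀ s ∈ T.faces, ∃ K ∈ T.faces, K.card = d + 1 ∧ s ⊆ K

/-- The elements (triangles, tetrahedra, ...) of the mesh: its `d`-dimensional simplices. -/
def elements {d : ℕ} (T : Geometry.SimplicialComplex ℝ (Pt d)) : Set (Finset (Pt d)) :=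
  {K | K ∈ T.faces ∧ K.card = d + 1}

/-- The discrete domain `Ω_h`: the union of the closed elements. -/
def domain {d : ℕ} (T : Geometry.SimplicialComplex ℝ (Pt d)) : Set (Pt d) :=
  ⋃ K ∈ elements T, convexHull ℝ (K : Set (Pt d))

/-- The boundary faces: the `(d-1)`-dimensional simplices that are a face of exactly one element. -/
def boundaryFaces {d : ℕ} (T : Geometry.SimplicialComplex ℝ (Pt d)) : Set (Finset (Pt d)) :=
  {F | F ∈ T.faces ∧ F.card = d ∧ ∃! K, K ∈ elements T ∧ F ⊆ K}

/-- The boundary `∂Ω_h` of the discrete domain: the union of the closed boundary faces. -/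
def bdry {d : ℕ} (T : Geometry.SimplicialComplex ℝ (Pt d)) : Set (Pt d) :=
  ⋃ F ∈ boundaryFaces T, convexHull ℝ (F : Set (Pt d))

/-- The surface measure `ds` on `∂Ω_h`: the `(d-1)`-dimensional Hausdorff measure, normalised so
as to agree with Lebesgue measure on hyperplanes. -/
def surf {d : ℕ} (T : Geometry.SimplicialComplex ℝ (Pt d)) : Measure (Pt d) :=
  (μHE[d - 1] : Measure (Pt d)).restrict (bdry T)

/-- The mesh is shape regular and quasi-uniform with mesh parameter `h`, with constant `σ`: every
element `K` contains a ball whose radius is at least `diam K / σ`, and its diameter is comparable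
to `h`. -/
structure IsRegular {d : ℕ} (T : Geometry.SimplicialComplex ℝ (Pt d)) (h σ : ℝ) : Prop where
  shape : ∀ K ∈ elements T, ∃ c r, Metric.diam (convexHull ℝ (K : Set (Pt d))) ≤ σ * r ∧
    Metric.closedBall c r ⊆ convexHull ℝ (K : Set (Pt d))
  diam_le : ∀ K ∈ elements T, Metric.diam (convexHull ℝ (K : Set (Pt d))) ≤ σ * h
  le_diam : ∀ K ∈ elements T, h ≤ σ * Metric.diam (convexHull ℝ (K : Set (Pt d)))

/-! ### Discrete spaces

Only the values on `Ω_h` (respectively almost everywhere on `∂Ω_h`) of a function matter below. -/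

/-- `V_h^k`: the continuous functions on `Ω_h` whose restriction to each element is a polynomial
of degree at most `k`. -/
def contPoly {d : ℕ} (T : Geometry.SimplicialComplex ℝ (Pt d)) (k : ℕ) :
    Submodule ℝ (Pt d → ℝ) where
  carrier := {v | ContinuousOn v (domain T) ∧ ∀ K ∈ elements T, ∃ p : MvPolynomial (Fin d) ℝ,
    p.totalDegree ≤ k ∧ ∀ x ∈ convexHull ℝ (K : Set (Pt d)), v x = polyVal p x}
  zero_mem' := ⟨continuousOn_const, fun _ _ => ⟨0, by simp, by simp [polyVal]⟩⟩
  add_mem' := by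
    rintro u v ⟨hu, hu'⟩ ⟨hv, hv'⟩
    refine ⟨hu.add hv, fun K hK => ?_⟩
    obtain ⟨p, hp, hp'⟩ := hu' K hK
    obtain ⟨q, hq, hq'⟩ := hv' K hK
    refine ⟨p + q, (MvPolynomial.totalDegree_add p q).trans (max_le hp hq), fun x hx => ?_⟩
    simp [hp' x hx, hq' x hx, polyVal]
  smul_mem' := by
    rintro c u ⟨hu, hu'⟩
    refine ⟨hu.const_smul c, fun K hK => ?_⟩
    obtain ⟨p, hp, hp'⟩ := hu' K hK
    refine ⟨c • p, (MvPolynomial.totalDegree_smul_le c p).trans hp, fun x hx => ?_⟩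
    simp [hp' x hx, polyVal, MvPolynomial.smul_eval]

/-- The functions on `∂Ω_h` that are on each boundary face (almost everywhere) a polynomial of
degree at most `k`, with no continuity between the faces. -/
def facePoly {d : ℕ} (T : Geometry.SimplicialComplex ℝ (Pt d)) (k : ℕ) :
    Submodule ℝ (Pt d → ℝ) where
  carrier := {η | ∀ F ∈ boundaryFaces T, ∃ p : MvPolynomial (Fin d) ℝ, p.totalDegree ≤ k ∧
    ∀ᵐ x ∂((μHE[d - 1] : Measure (Pt d)).restrict (convexHull ℝ (F : Set (Pt d)))),
      η x = polyVal p x}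
  zero_mem' := fun _ _ => ⟨0, by simp, by simp [polyVal]⟩
  add_mem' := by
    intro u v hu hv F hF
    obtain ⟨p, hp, hp'⟩ := hu F hF
    obtain ⟨q, hq, hq'⟩ := hv F hF
    refine ⟨p + q, (MvPolynomial.totalDegree_add p q).trans (max_le hp hq), ?_⟩
    filter_upwards [hp', hq'] with x hx hx'
    simp [hx, hx', polyVal]
  smul_mem' := by
    intro c u hu F hF
    obtain ⟨p, hp, hp'⟩ := hu F hF
    refine ⟨c • p, (MvPolynomial.totalDegree_smul_le c p).trans hp, ?_⟩
    filter_upwards [hp'] with x hx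
    simp [hx, polyVal, MvPolynomial.smul_eval]

/-! ### Norms and forms -/

/-- `‖∇v‖_{Ω_h}`. The gradient is the classical one, which exists in the interior of every element
for `v` in `contPoly`. -/
def gradNorm {d : ℕ} (T : Geometry.SimplicialComplex ℝ (Pt d)) (v : Pt d → ℝ) : ℝ :=
  √(∫ x in domain T, ‖gradient v x‖ ^ 2)

/-- `(f, g)_{∂Ω_h}`. -/
def bdryInner {d : ℕ} (T : Geometry.SimplicialComplex ℝ (Pt d)) (f g : Pt d → ℝ) : ℝ :=
  ∫ x, f x * g x ∂(surf T)

/-- `‖f‖_{∂Ω_h}`. -/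
def bdryNorm {d : ℕ} (T : Geometry.SimplicialComplex ℝ (Pt d)) (f : Pt d → ℝ) : ℝ :=
  √(∫ x, f x ^ 2 ∂(surf T))

/-- The triple norm `‖∇v‖_{Ω_h} + ‖h^{-1/2} v‖_{∂Ω_h} + ‖h^{1/2} μ‖_{∂Ω_h}`. -/
def tripleNorm {d : ℕ} (T : Geometry.SimplicialComplex ℝ (Pt d)) (h : ℝ) (v μ : Pt d → ℝ) : ℝ :=
  gradNorm T v + bdryNorm T (fun x => h ^ (-(1 / 2) : ℝ) * v x)
    + bdryNorm T (fun x => h ^ (1 / 2 : ℝ) * μ x)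

/-- The bilinear form of the boundary value corrected Lagrange multiplier method,
`A(u, lam; v, μ) = (∇u, ∇v)_{Ω_h} + (lam, v)_{∂Ω_h} + (u, μ)_{∂Ω_h} - (ρ lam, μ)_{∂Ω_h}`. -/
def formA {d : ℕ} (T : Geometry.SimplicialComplex ℝ (Pt d)) (ρ u lam v μ : Pt d → ℝ) : ℝ :=
  (∫ x in domain T, inner ℝ (gradient u x) (gradient v x))
    + bdryInner T lam v + bdryInner T u μ - bdryInner T (fun x => ρ x * lam x) μ

/-- The discrete inf-sup condition for the pair of spaces `V × Λ`, with constant `C`. -/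
def InfSup {d : ℕ} (T : Geometry.SimplicialComplex ℝ (Pt d)) (h C : ℝ)
    (V Λ : Submodule ℝ (Pt d → ℝ)) : Prop :=
  ∀ η ∈ Λ, ∃ v ∈ V,
    bdryNorm T (fun x => h ^ (1 / 2 : ℝ) * η x) ^ 2 ≤ C * bdryInner T η v ∧
    gradNorm T v + bdryNorm T (fun x => h ^ (-(1 / 2) : ℝ) * v x)
      ≤ C * bdryNorm T (fun x => h ^ (1 / 2 : ℝ) * η x)

end BoundaryCorrection

end

open MeasureTheory
open scoped MeasureTheory

noncomputable section

namespace BoundaryCorrection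

/-! ### Polynomials on balls -/

section Poly

variable {d : ℕ}

/-! Let `w` realise the inf-sup condition for `η`, and let `c` be a facewise constant close to the
trace of `y`. The test pair is `v = y + α w`, `μ = -η + β h⁻¹ c`, and `c` is an admissible
multiplier because it has degree `0 ≤ k - 1`. The pairings of `η` with `y` cancel, leaving `‖∇y‖²`,
control of `h^{1/2} η` from `α (η, w)`, control of `h^{-1/2} y` from `β h⁻¹ (y, c)`, and terms to
absorb. The lower bound on `ρ` makes `(ρ η, η)` at worst a fixed fraction of what `w` supplies; this
fraction depends on `Cis` alone. The two-sided bound on `ρ` enters only through `β h⁻¹ (ρ η, c)` and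
is met by taking `β` small, so `Cbd` does not depend on `Cρ`. This algebra is
`exists_stability_constants`.

The analytic input is `exists_facewise_constant_approx`: `‖y - c‖² ≤ C h ‖∇y‖²` on the boundary. An
element lies between concentric balls of radii `r` and `σ r`, so a compactness-free
finite-dimensional comparison on the unit ball plus scaling bounds the oscillation of a polynomial
by its gradient, without a reference simplex. Integrating over a face of area at most a multiple of
`h^(d-1)` and summing gives the estimate. -/

theorem contDiff_polyVal (p : MvPolynomial (Fin d) ℝ) : ContDiff ℝ ⊤ (polyVal p) := by
  induction p using MvPolynomial.induction_on with
  | C a =>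
    have : polyVal (MvPolynomial.C a : MvPolynomial (Fin d) ℝ) = fun _ => a := by
      ext x; simp [polyVal]
    rw [this]; exact contDiff_const
  | add p q hp hq =>
    have : polyVal (p + q) = fun x => polyVal p x + polyVal q x := by ext x; simp [polyVal]
    rw [this]; exact hp.add hq
  | mul_X p i hp =>
    have : polyVal (p * MvPolynomial.X i) = fun x => polyVal p x * x i := by
      ext x; simp [polyVal]
    rw [this]; exact hp.mul (by fun_prop)

theorem differentiable_polyVal (p : MvPolynomial (Fin d) ℝ) : Differentiable ℝ (polyVal p) :=
  (contDiff_polyVal p).differentiable (by simp)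

theorem continuous_gradient_polyVal (p : MvPolynomial (Fin d) ℝ) :
    Continuous (gradient (polyVal p)) :=
  (InnerProductSpace.toDual ℝ (Pt d)).symm.continuous.comp
    ((contDiff_polyVal p).continuous_fderiv (by simp))

theorem gradient_add {f g : Pt d → ℝ} {x : Pt d} (hf : DifferentiableAt ℝ f x)
    (hg : DifferentiableAt ℝ g x) :
    gradient (fun y => f y + g y) x = gradient f x + gradient g x := by
  simp [gradient, fderiv_fun_add hf hg]

theorem gradient_const_smul {f : Pt d → ℝ} {x : Pt d} (c : ℝ) (hf : DifferentiableAt ℝ f x) :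
    gradient (fun y => c * f y) x = c • gradient f x := by
  simp [gradient, fderiv_const_mul hf]

/-- A linear map on a finite dimensional space is bounded by any other one with smaller kernel. -/
theorem exists_norm_le_of_ker_le {E F G : Type*} [AddCommGroup E] [Module ℝ E]
    [FiniteDimensional ℝ E] [NormedAddCommGroup F] [NormedSpace ℝ F] [NormedAddCommGroup G]
    [NormedSpace ℝ G] (T : E →ₗ[ℝ] F) (U : E →ₗ[ℝ] G)
    (h : LinearMap.ker T ≤ LinearMap.ker U) : ∃ C, 0 ≤ C ∧ ∀ e, ‖U e‖ ≤ C * ‖T e‖ := by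
  -- `U` factors through the range of `T`, which is finite dimensional, so the factor is
  -- automatically bounded.
  let S : LinearMap.range T →ₗ[ℝ] G :=
    ((LinearMap.ker T).liftQ U h).comp T.quotKerEquivRange.symm.toLinearMap
  refine ⟨‖S.toContinuousLinearMap‖, by positivity, fun e => ?_⟩
  have hS : S ⟨T e, LinearMap.mem_range_self T e⟩ = U e := by
    have : T.quotKerEquivRange.symm ⟨T e, LinearMap.mem_range_self T e⟩
        = (LinearMap.ker T).mkQ e := by
      rw [LinearEquiv.symm_apply_eq]; rfl
    simp only [S, LinearMap.comp_apply, LinearEquiv.coe_coe, this]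
    simp
  have := S.toContinuousLinearMap.le_opNorm ⟨T e, LinearMap.mem_range_self T e⟩
  rw [LinearMap.coe_toContinuousLinearMap', hS] at this
  simpa using this

/-- A polynomial whose gradient vanishes on the unit ball is constant. -/
theorem polyVal_eq_of_gradient_eq_zero (p : MvPolynomial (Fin d) ℝ)
    (hp : ∀ x ∈ Metric.ball (0 : Pt d) 1, gradient (polyVal p) x = 0) (x z : Pt d) :
    polyVal p x = polyVal p z := by
  have h1 : ∀ x ∈ Metric.ball (0 : Pt d) 1, polyVal p x = polyVal p 0 := by
    intro x hx
    have := Convex.norm_image_sub_le_of_norm_fderivWithin_le (𝕜 := ℝ) (f := polyVal p) (C := 0)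
      (s := Metric.ball (0 : Pt d) 1) (x := 0) (y := x)
      (differentiable_polyVal p).differentiableOn (fun y hy => ?_) (convex_ball _ _) (by simp) hx
    · simpa [sub_eq_zero] using this
    · rw [fderivWithin_of_isOpen Metric.isOpen_ball hy]
      simpa [gradient] using hp y hy
  -- The cube `(0, 1/(d+1))ᵈ` lies in the unit ball, and a polynomial is determined by its values on
  -- a product of infinite sets.
  let s : Set ℝ := Set.Ioo 0 (1 / (d + 1 : ℝ))
  have hs : s.Infinite := Set.Ioo_infinite (by positivity)
  have h2 : p = MvPolynomial.C (polyVal p 0) := by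
    refine MvPolynomial.funext_set (fun _ => s) (fun _ => hs) fun w hw => ?_
    have hw' : (WithLp.toLp 2 w : Pt d) ∈ Metric.ball (0 : Pt d) 1 := by
      rw [mem_ball_zero_iff, EuclideanSpace.norm_eq, Real.sqrt_lt' one_pos]
      have hd : (0 : ℝ) < d + 1 := by positivity
      calc ∑ i, ‖(WithLp.toLp 2 w : Pt d) i‖ ^ 2 ≤ ∑ _i : Fin d, (1 / (d + 1 : ℝ)) ^ 2 := by
            refine Finset.sum_le_sum fun i _ => ?_
            have := hw i trivial
            simp only [Real.norm_eq_abs, sq_abs]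
            exact pow_le_pow_left₀ this.1.le this.2.le 2
        _ = d / (d + 1) ^ 2 := by simp; field_simp
        _ < 1 ^ 2 := by rw [div_lt_iff₀ (by positivity)]; nlinarith
    have := h1 _ hw'
    simpa [polyVal] using this
  rw [h2]; simp [polyVal]

/-- A continuous function on a compact set of finite measure is square integrable. -/
theorem memLp_restrict_of_isCompact {E : Type*} [NormedAddCommGroup E] [SecondCountableTopology E]
    {μ : Measure (Pt d)} {s : Set (Pt d)} (hs : IsCompact s) (hμ : μ s < ⊤) {f : Pt d → E}
    (hf : ContinuousOn f s) : MemLp f 2 (μ.restrict s) := by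
  have : IsFiniteMeasure (μ.restrict s) := isFiniteMeasure_restrict.2 hμ.ne
  obtain ⟨C, hC⟩ := hs.exists_bound_of_continuousOn hf
  refine MemLp.of_bound (hf.aestronglyMeasurable hs.measurableSet) C ?_
  filter_upwards [ae_restrict_mem hs.measurableSet] with x hx using hC x hx

/-- On polynomials of bounded degree, the oscillation on a ball is controlled by the gradient on
the unit ball. -/
theorem exists_oscillation_le_gradient (d m : ℕ) (σ : ℝ) :
    ∃ C, 0 ≤ C ∧ ∀ p : MvPolynomial (Fin d) ℝ, p.totalDegree ≤ m →
      ∀ x ∈ Metric.closedBall (0 : Pt d) σ, ∀ z ∈ Metric.closedBall (0 : Pt d) σ,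
      (polyVal p x - polyVal p z) ^ 2 ≤
        C * ∫ y in Metric.closedBall (0 : Pt d) 1, ‖gradient (polyVal p) y‖ ^ 2 := by
  let B := Metric.closedBall (0 : Pt d) σ
  let ν : Measure (Pt d) := volume.restrict (Metric.closedBall (0 : Pt d) 1)
  have : CompactSpace B := isCompact_iff_compactSpace.1 (isCompact_closedBall _ _)
  have hfin : IsFiniteMeasure ν :=
    isFiniteMeasure_restrict.2 (isCompact_closedBall _ _).measure_lt_top.ne
  have hL : ∀ p : MvPolynomial (Fin d) ℝ, MemLp (gradient (polyVal p)) 2 ν := fun p =>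
    memLp_restrict_of_isCompact (isCompact_closedBall _ _)
      (isCompact_closedBall _ _).measure_lt_top (continuous_gradient_polyVal p).continuousOn
  let E := MvPolynomial.restrictTotalDegree (Fin d) ℝ m
  -- `U` records all differences of values in the sup norm and `T` the gradient in `L²`; the claim
  -- is that `T p = 0` forces `U p = 0`.
  let U : E →ₗ[ℝ] C(B × B, ℝ) :=
    { toFun := fun p => ⟨fun x => polyVal p.1 x.1 - polyVal p.1 x.2, by
        have := (contDiff_polyVal p.1).continuous
        fun_prop⟩
      map_add' := fun p q => by ext x; simp [polyVal]; ring
      map_smul' := fun c p => by ext x; simp [polyVal, MvPolynomial.smul_eval]; ring }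
  let T : E →ₗ[ℝ] Lp (Pt d) 2 ν :=
    { toFun := fun p => (hL p.1).toLp
      map_add' := fun p q => by
        rw [← MemLp.toLp_add]
        congr 1
        ext1 x
        rw [Pi.add_apply, ← gradient_add (differentiable_polyVal _ x) (differentiable_polyVal _ x)]
        congr 1; ext y; simp [polyVal]
      map_smul' := fun c p => by
        rw [RingHom.id_apply, ← MemLp.toLp_const_smul]
        congr 1
        ext1 x
        rw [Pi.smul_apply, ← gradient_const_smul _ (differentiable_polyVal _ x)]
        congr 1; ext y; simp [polyVal, MvPolynomial.smul_eval] }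
  obtain ⟨C, hC, h⟩ := exists_norm_le_of_ker_le T U (by
    intro p hp
    rw [LinearMap.mem_ker] at hp ⊢
    have h0 : gradient (polyVal p.1) =ᵐ[ν] 0 := by
      have := (hL p.1).coeFn_toLp
      have h2 : (hL p.1).toLp = 0 := hp
      rw [h2] at this
      exact this.symm.trans (Lp.coeFn_zero _ _ _)
    -- Vanishing almost everywhere becomes vanishing everywhere on the open ball, by continuity.
    have h1 : Set.EqOn (gradient (polyVal p.1)) 0 (Metric.ball 0 1) :=
      Measure.eqOn_open_of_ae_eq
        (ae_restrict_of_ae_restrict_of_subset Metric.ball_subset_closedBall h0)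
        Metric.isOpen_ball (continuous_gradient_polyVal _).continuousOn continuousOn_const
    ext x
    simpa [U, sub_eq_zero] using polyVal_eq_of_gradient_eq_zero p.1 (fun x hx => h1 hx) x.1 x.2)
  refine ⟨C ^ 2, sq_nonneg _, fun p hp x hx z hz => ?_⟩
  let e : E := ⟨p, (MvPolynomial.mem_restrictTotalDegree _ _ _).2 hp⟩
  have h1 : ‖polyVal p x - polyVal p z‖ ≤ ‖U e‖ := (U e).norm_coe_le_norm (⟨x, hx⟩, ⟨z, hz⟩)
  have h2 : ‖T e‖ ^ 2 = ∫ y in Metric.closedBall (0 : Pt d) 1, ‖gradient (polyVal p) y‖ ^ 2 := by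
    rw [← real_inner_self_eq_norm_sq, L2.inner_def]
    refine integral_congr_ae ?_
    filter_upwards [(hL p).coeFn_toLp] with y hy
    have : (T e : Pt d → Pt d) y = gradient (polyVal p) y := hy
    rw [this, real_inner_self_eq_norm_sq]
  rw [← h2, ← mul_pow, ← sq_abs]
  exact pow_le_pow_left₀ (abs_nonneg _) (h1.trans (h e)) 2

/-- Dilation and translation of a polynomial. -/
theorem exists_polyVal_comp_affine (p : MvPolynomial (Fin d) ℝ) (c : Pt d) (r : ℝ) :
    ∃ q : MvPolynomial (Fin d) ℝ, q.totalDegree ≤ p.totalDegree ∧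
      ∀ x, polyVal q x = polyVal p (c + r • x) := by
  let f : Fin d → MvPolynomial (Fin d) ℝ := fun i =>
    MvPolynomial.C (c i) + MvPolynomial.C r * MvPolynomial.X i
  have hf : ∀ i, (f i).totalDegree ≤ 1 := fun i => by
    refine (MvPolynomial.totalDegree_add _ _).trans (max_le (by simp) ?_)
    refine (MvPolynomial.totalDegree_mul _ _).trans ?_
    simp
  refine ⟨MvPolynomial.bind₁ f p, ?_, fun x => ?_⟩
  · rw [MvPolynomial.bind₁, MvPolynomial.aeval_def, MvPolynomial.eval₂_eq]
    refine MvPolynomial.totalDegree_finsetSum_le fun s hs => ?_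
    refine (MvPolynomial.totalDegree_mul _ _).trans ?_
    rw [MvPolynomial.algebraMap_eq, MvPolynomial.totalDegree_C, zero_add]
    refine (MvPolynomial.totalDegree_finsetProd _ _).trans ?_
    refine le_trans ?_ (MvPolynomial.le_totalDegree hs)
    refine Finset.sum_le_sum fun i _ => ?_
    refine (MvPolynomial.totalDegree_pow _ _).trans ?_
    simpa using Nat.mul_le_mul_left (s i) (hf i)
  · rw [polyVal, polyVal, MvPolynomial.eval, MvPolynomial.eval₂Hom_bind₁]
    congr 2
    ext i
    simp [f]

theorem gradient_comp_affine {f : Pt d → ℝ} (hf : Differentiable ℝ f) (c : Pt d) (r : ℝ)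
    (x : Pt d) : gradient (fun y => f (c + r • y)) x = r • gradient f (c + r • x) := by
  have h : HasFDerivAt (fun y : Pt d => c + r • y) (r • ContinuousLinearMap.id ℝ (Pt d)) x := by
    simpa using ((hasFDerivAt_id x).const_smul r).const_add c
  have := ((hf (c + r • x)).hasFDerivAt.comp x h).fderiv
  simp only [Function.comp_def] at this
  rw [gradient, this, ContinuousLinearMap.comp_smul, ContinuousLinearMap.comp_id, map_smul]
  rfl

theorem setIntegral_closedBall_comp_affine (g : Pt d → ℝ) (c : Pt d) {r : ℝ} (hr : 0 < r) :
    ∫ x in Metric.closedBall (0 : Pt d) 1, g (c + r • x) =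
      (r ^ d)⁻¹ * ∫ x in Metric.closedBall c r, g x := by
  have h1 := Measure.setIntegral_comp_smul_of_pos (volume : Measure (Pt d)) (fun x => g (c + x))
    (Metric.closedBall 0 1) hr
  rw [h1, smul_closedBall _ _ zero_le_one]
  simp only [finrank_euclideanSpace, Fintype.card_fin, smul_eq_mul, smul_zero, mul_one,
    Real.norm_eq_abs, abs_of_pos hr]
  congr 1
  have h2 := (measurePreserving_add_left (volume : Measure (Pt d)) c).setIntegral_preimage_emb
    (MeasurableEquiv.addLeft c).measurableEmbedding g (Metric.closedBall c r)
  rw [← h2]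
  simp

/-- On polynomials of bounded degree, the oscillation on a ball is controlled by the gradient on
a smaller concentric ball. -/
theorem exists_oscillation_le_gradient_closedBall (d m : ℕ) (σ : ℝ) :
    ∃ C, 0 ≤ C ∧ ∀ p : MvPolynomial (Fin d) ℝ, p.totalDegree ≤ m → ∀ (c : Pt d) (r : ℝ), 0 < r →
      ∀ x ∈ Metric.closedBall c (σ * r), ∀ z ∈ Metric.closedBall c (σ * r),
      r ^ d * (polyVal p x - polyVal p z) ^ 2 ≤
        C * r ^ 2 * ∫ y in Metric.closedBall c r, ‖gradient (polyVal p) y‖ ^ 2 := by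
  obtain ⟨C, hC, h⟩ := exists_oscillation_le_gradient d m σ
  refine ⟨C, hC, fun p hp c r hr x hx z hz => ?_⟩
  obtain ⟨q, hq, hpq⟩ := exists_polyVal_comp_affine p c r
  have key : ∀ x ∈ Metric.closedBall c (σ * r), r⁻¹ • (x - c) ∈ Metric.closedBall (0 : Pt d) σ ∧
      polyVal q (r⁻¹ • (x - c)) = polyVal p x := by
    intro x hx
    constructor
    · rw [mem_closedBall_zero_iff, norm_smul, norm_inv, Real.norm_eq_abs, abs_of_pos hr,
        inv_mul_le_iff₀ hr, mul_comm, ← dist_eq_norm]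
      exact hx
    · rw [hpq, smul_smul, mul_inv_cancel₀ hr.ne', one_smul, add_sub_cancel]
  have h1 := h q (hq.trans hp) _ (key x hx).1 _ (key z hz).1
  rw [(key x hx).2, (key z hz).2] at h1
  have h2 : ∀ y, ‖gradient (polyVal q) y‖ ^ 2 =
      (fun y => r ^ 2 * ‖gradient (polyVal p) y‖ ^ 2) (c + r • y) := fun y => by
    have : polyVal q = fun y => polyVal p (c + r • y) := funext hpq
    rw [this, gradient_comp_affine (differentiable_polyVal p), norm_smul, mul_pow]
    simp
  -- The chain rule contributes `r ^ 2` and the change of variables `(r ^ d)⁻¹`.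
  rw [integral_congr_ae (Filter.Eventually.of_forall h2),
    setIntegral_closedBall_comp_affine (fun y => r ^ 2 * ‖gradient (polyVal p) y‖ ^ 2) c hr,
    integral_const_mul] at h1
  have h3 := mul_le_mul_of_nonneg_left h1 (pow_pos hr d).le
  refine h3.trans (le_of_eq ?_)
  field_simp

end Poly

/-! ### Hausdorff measure of simplices -/

section Simplex

variable {d : ℕ}

/-- A simplex with `n + 1` vertices is covered by a Lipschitz image of the cube `[0, 1]ⁿ`. -/
theorem exists_lipschitzWith_convexHull_subset {s : Finset (Pt d)} {x₀ : Pt d} (hx₀ : x₀ ∈ s)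
    {D : NNReal} (hD : ∀ x ∈ s, dist x x₀ ≤ D) :
    ∃ f : (↥(s.erase x₀) → ℝ) → Pt d, LipschitzWith ((s.erase x₀).card * D) f ∧
      convexHull ℝ (s : Set (Pt d)) ⊆ f '' Set.Icc 0 1 := by
  -- The barycentric weights of the vertices other than `x₀` serve as coordinates.
  refine ⟨fun t => x₀ + ∑ i, t i • ((i : Pt d) - x₀), ?_, ?_⟩
  · refine LipschitzWith.of_dist_le_mul fun t u => ?_
    rw [dist_add_left, dist_eq_norm, ← Finset.sum_sub_distrib]
    calc ‖∑ i, (t i • ((i : Pt d) - x₀) - u i • ((i : Pt d) - x₀))‖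
        ≤ ∑ i : ↥(s.erase x₀), dist t u * D := by
          refine norm_sum_le_of_le _ fun i _ => ?_
          rw [← sub_smul, norm_smul, ← dist_eq_norm, ← dist_eq_norm]
          exact mul_le_mul (dist_le_pi_dist t u i) (hD _ (Finset.mem_of_mem_erase i.2))
            dist_nonneg dist_nonneg
      _ = _ := by simp; ring
  · intro x hx
    obtain ⟨w, hw0, hw1, rfl⟩ := Finset.mem_convexHull'.1 hx
    refine ⟨fun i => w i, ⟨fun i => hw0 _ (Finset.mem_of_mem_erase i.2), fun i => ?_⟩, ?_⟩
    · change w i ≤ 1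
      rw [← hw1]
      exact Finset.single_le_sum hw0 (Finset.mem_of_mem_erase i.2)
    · simp only
      rw [Finset.sum_coe_sort (s.erase x₀) (fun i => w i • (i - x₀))]
      have h1 : ∑ i ∈ s.erase x₀, w i • (i - x₀) = ∑ i ∈ s, w i • (i - x₀) := by
        rw [← Finset.sum_erase_add s _ hx₀]; simp
      rw [h1]
      simp only [smul_sub, Finset.sum_sub_distrib, ← Finset.sum_smul, hw1, one_smul]
      abel

/-- A simplex with at most `n` vertices is negligible for the `n`-dimensional measure. -/
theorem euclideanHausdorffMeasure_convexHull_eq_zero {s : Finset (Pt d)} {n : ℕ}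
    (hs : s.card ≤ n) : (μHE[n] : Measure (Pt d)) (convexHull ℝ (s : Set (Pt d))) = 0 := by
  obtain rfl | ⟨x₀, hx₀⟩ := s.eq_empty_or_nonempty
  · simp
  obtain ⟨D, hD⟩ : ∃ D : NNReal, ∀ x ∈ s, dist x x₀ ≤ D :=
    ⟨⟨Metric.diam (s : Set (Pt d)), Metric.diam_nonneg⟩, fun x hx =>
      Metric.dist_le_diam_of_mem s.finite_toSet.isBounded hx hx₀⟩
  obtain ⟨f, hf, hsub⟩ := exists_lipschitzWith_convexHull_subset hx₀ hD
  -- The parametrisation uses `s.card - 1 < n` coordinates, and Lipschitz maps do not raise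
  -- Hausdorff dimension.
  have h0 : dimH (convexHull ℝ (s : Set (Pt d))) < (n : NNReal) := by
    calc dimH (convexHull ℝ (s : Set (Pt d))) ≤ dimH (f '' Set.Icc 0 1) := dimH_mono hsub
      _ ≤ dimH (Set.Icc 0 1) := hf.dimH_image_le _
      _ ≤ dimH (Set.univ : Set (↥(s.erase x₀) → ℝ)) := dimH_mono (Set.subset_univ _)
      _ = ((s.erase x₀).card : ENNReal) := by rw [Real.dimH_univ_pi]; simp
      _ < (n : NNReal) := by
        have := Finset.card_erase_lt_of_mem hx₀
        exact_mod_cast this.trans_le hs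
  have := hausdorffMeasure_of_dimH_lt h0
  rw [Measure.euclideanHausdorffMeasure_def, Measure.smul_apply]
  simpa using Or.inr this

/-- The `n`-dimensional measure of a simplex with `n + 1` vertices and diameter at most `D` is
at most a constant times `Dⁿ`. -/
theorem exists_euclideanHausdorffMeasure_convexHull_le (d n : ℕ) :
    ∃ C : NNReal, ∀ (s : Finset (Pt d)) (D : NNReal), s.card = n + 1 →
      (∀ x ∈ s, ∀ y ∈ s, dist x y ≤ D) →
      (μHE[n] : Measure (Pt d)) (convexHull ℝ (s : Set (Pt d))) ≤ ((C * D ^ n : NNReal) : ENNReal) := by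
  -- The scalar factor relates `μHE[n]` to `μH[n]`; `n ^ n` comes from the Lipschitz constant `n *
  -- D`.
  refine ⟨Measure.addHaarScalarFactor (volume : Measure (EuclideanSpace ℝ (Fin n))) μH[n] * n ^ n,
    fun s D hs hD => ?_⟩
  obtain ⟨x₀, hx₀⟩ : s.Nonempty := Finset.card_pos.1 (by omega)
  obtain ⟨f, hf, hsub⟩ := exists_lipschitzWith_convexHull_subset hx₀ (fun x hx => hD x hx x₀ hx₀)
  have hcard : (s.erase x₀).card = n := by rw [Finset.card_erase_of_mem hx₀]; omega
  have h1 : μH[(n : ℝ)] (convexHull ℝ (s : Set (Pt d))) ≤ ((n * D : NNReal) : ENNReal) ^ n := by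
    refine (measure_mono hsub).trans ((hf.hausdorffMeasure_image_le (by positivity) _).trans ?_)
    have h2 : (μH[(n : ℝ)] : Measure (↥(s.erase x₀) → ℝ)) = volume := by
      rw [← hausdorffMeasure_pi_real]; simp [hcard]
    rw [h2, Real.volume_Icc_pi, hcard]
    simp
  rw [Measure.euclideanHausdorffMeasure_def, Measure.smul_apply, ENNReal.smul_def, smul_eq_mul]
  refine (mul_le_mul_right h1 _).trans (le_of_eq ?_)
  push_cast
  ring

end Simplex

/-! ### Integration on the mesh -/

section Mesh

variable {d : ℕ} {T : Geometry.SimplicialComplex ℝ (Pt d)}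

theorem isCompact_convexHull_finset (s : Finset (Pt d)) :
    IsCompact (convexHull ℝ (s : Set (Pt d))) :=
  s.finite_toSet.isCompact_convexHull (𝕜 := ℝ)

theorem finite_elements (hT : IsMesh T) : (elements T).Finite :=
  hT.finite.subset fun _ h => h.1

theorem finite_boundaryFaces (hT : IsMesh T) : (boundaryFaces T).Finite :=
  hT.finite.subset fun _ h => h.1

theorem isCompact_bdry (hT : IsMesh T) : IsCompact (bdry T) :=
  (finite_boundaryFaces hT).isCompact_biUnion fun _ _ => isCompact_convexHull_finset _

theorem bdry_subset_domain : bdry T ⊆ domain T := by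
  refine Set.iUnion₂_subset fun F hF => ?_
  obtain ⟨K, ⟨hK, hFK⟩, -⟩ := hF.2.2
  exact (convexHull_mono (Finset.coe_subset.2 hFK)).trans
    (Set.subset_biUnion_of_mem (u := fun K : Finset (Pt d) => convexHull ℝ (K : Set (Pt d))) hK)

theorem euclideanHausdorffMeasure_convexHull_lt_top {s : Finset (Pt d)} {n : ℕ}
    (hs : s.card = n + 1) : (μHE[n] : Measure (Pt d)) (convexHull ℝ (s : Set (Pt d))) < ⊤ := by
  obtain ⟨C, hC⟩ := exists_euclideanHausdorffMeasure_convexHull_le d n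
  exact (hC s ⟨Metric.diam (s : Set (Pt d)), Metric.diam_nonneg⟩ hs fun x hx y hy =>
    Metric.dist_le_diam_of_mem s.finite_toSet.isBounded hx hy).trans_lt ENNReal.coe_lt_top

theorem euclideanHausdorffMeasure_bdry_lt_top (hd : 2 ≤ d) (hT : IsMesh T) :
    (μHE[d - 1] : Measure (Pt d)) (bdry T) < ⊤ :=
  measure_biUnion_lt_top (finite_boundaryFaces hT) fun _ hF =>
    euclideanHausdorffMeasure_convexHull_lt_top (by have := hF.2.1; omega)

/-- Distinct simplices of the same dimension overlap in a set of measure zero. -/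
theorem aedisjoint_convexHull {s t : Finset (Pt d)} (hs : s ∈ T.faces) (ht : t ∈ T.faces) {n : ℕ}
    (hsn : s.card = n + 1) (htn : t.card = n + 1) (hst : s ≠ t) :
    AEDisjoint (μHE[n] : Measure (Pt d)) (convexHull ℝ (s : Set (Pt d)))
      (convexHull ℝ (t : Set (Pt d))) := by
  classical
  -- Conformity puts the overlap in the hull of the common vertices, of which there are at most `n`.
  refine measure_mono_null (T.inter_subset_convexHull hs ht) ?_
  rw [← Finset.coe_inter]
  refine euclideanHausdorffMeasure_convexHull_eq_zero (Nat.le_of_lt_succ ?_)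
  rw [Nat.succ_eq_add_one, ← hsn]
  refine Finset.card_lt_card (Finset.inter_subset_left.ssubset_of_ne fun h => hst ?_)
  exact Finset.eq_of_subset_of_card_le (Finset.inter_eq_left.1 h) (by omega)

/-- Overlaps are null, so the integral is additive. It serves both the elements (`n = d`) and the
boundary faces (`n = d - 1`). -/
theorem setIntegral_biUnion_convexHull {n : ℕ} {S : Set (Finset (Pt d))} (hS : S.Finite)
    (hST : S ⊆ T.faces) (hn : ∀ s ∈ S, s.card = n + 1) {f : Pt d → ℝ}
    (hf : IntegrableOn f (⋃ s ∈ S, convexHull ℝ (s : Set (Pt d))) μHE[n]) :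
    ∫ x in ⋃ s ∈ S, convexHull ℝ (s : Set (Pt d)), f x ∂μHE[n] =
      ∑ s ∈ hS.toFinset, ∫ x in convexHull ℝ (s : Set (Pt d)), f x ∂μHE[n] := by
  have : Fintype S := hS.fintype
  rw [Set.biUnion_eq_iUnion] at hf ⊢
  rw [integral_iUnion_ae (fun s => (isCompact_convexHull_finset _).measurableSet.nullMeasurableSet)
    (fun s t hst => aedisjoint_convexHull (hST s.2) (hST t.2) (hn _ s.2) (hn _ t.2)
      (Subtype.coe_injective.ne hst)) hf, tsum_fintype]
  exact Finset.sum_bij (fun s _ => s.1) (fun s _ => by simp) (fun _ _ _ _ h => Subtype.ext h)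
    (fun s hs => ⟨⟨s, by simpa using hs⟩, by simp, rfl⟩) (fun _ _ => rfl)

theorem memLp_biUnion_convexHull {E : Type*} [NormedAddCommGroup E] {μ : Measure (Pt d)}
    {S : Set (Finset (Pt d))} (hS : S.Finite) {f : Pt d → E}
    (hf : ∀ s ∈ S, MemLp f 2 (μ.restrict (convexHull ℝ (s : Set (Pt d))))) :
    MemLp f 2 (μ.restrict (⋃ s ∈ S, convexHull ℝ (s : Set (Pt d)))) := by
  have : Finite S := hS
  have hm : AEStronglyMeasurable f (μ.restrict (⋃ s ∈ S, convexHull ℝ (s : Set (Pt d)))) := by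
    rw [Set.biUnion_eq_iUnion, aestronglyMeasurable_iUnion_iff]
    exact fun s => (hf s s.2).1
  rw [memLp_two_iff_integrable_sq_norm hm]
  refine (integrableOn_finite_biUnion hS).2 fun s hs => ?_
  exact (memLp_two_iff_integrable_sq_norm (hf s hs).1).1 (hf s hs)

theorem memLp_of_mem_contPoly (hd : 2 ≤ d) (hT : IsMesh T) {m : ℕ} {v : Pt d → ℝ}
    (hv : v ∈ contPoly T m) : MemLp v 2 (surf T) :=
  memLp_restrict_of_isCompact (isCompact_bdry hT) (euclideanHausdorffMeasure_bdry_lt_top hd hT)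
    (hv.1.mono bdry_subset_domain)

theorem memLp_of_mem_facePoly (hd : 2 ≤ d) (hT : IsMesh T) {k : ℕ} {η : Pt d → ℝ}
    (hη : η ∈ facePoly T k) : MemLp η 2 (surf T) := by
  refine memLp_biUnion_convexHull (finite_boundaryFaces hT) fun F hF => ?_
  obtain ⟨p, -, hp⟩ := hη F hF
  refine (memLp_congr_ae hp).2 ?_
  exact memLp_restrict_of_isCompact (isCompact_convexHull_finset _)
    (euclideanHausdorffMeasure_convexHull_lt_top (by have := hF.2.1; omega))
    (contDiff_polyVal p).continuous.continuousOn

/-- The frontier of a convex set is Lebesgue null. This matters because a gradient is determined by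
a polynomial on an element only at points where the two functions agree in a full neighbourhood. -/
theorem ae_mem_interior_convexHull (s : Finset (Pt d)) :
    ∀ᵐ x ∂(volume.restrict (convexHull ℝ (s : Set (Pt d)))),
      x ∈ interior (convexHull ℝ (s : Set (Pt d))) := by
  have h1 := (convex_convexHull ℝ (s : Set (Pt d))).addHaar_frontier volume
  rw [(isCompact_convexHull_finset s).isClosed.frontier_eq] at h1
  rw [ae_restrict_iff' (isCompact_convexHull_finset s).measurableSet]
  filter_upwards [measure_eq_zero_iff_ae_notMem.1 h1] with x hx hx'
  by_contra h
  exact hx ⟨hx', h⟩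

theorem ae_eventuallyEq_of_eqOn_convexHull {s : Finset (Pt d)} {v w : Pt d → ℝ}
    (h : Set.EqOn v w (convexHull ℝ (s : Set (Pt d)))) :
    ∀ᵐ x ∂(volume.restrict (convexHull ℝ (s : Set (Pt d)))), v =ᶠ[nhds x] w := by
  filter_upwards [ae_mem_interior_convexHull s] with x hx
  exact h.eventuallyEq_of_mem (mem_interior_iff_mem_nhds.1 hx)

theorem gradient_ae_eq_of_eqOn_convexHull {s : Finset (Pt d)} {v w : Pt d → ℝ}
    (h : Set.EqOn v w (convexHull ℝ (s : Set (Pt d)))) :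
    gradient v =ᵐ[volume.restrict (convexHull ℝ (s : Set (Pt d)))] gradient w := by
  filter_upwards [ae_eventuallyEq_of_eqOn_convexHull h] with x hx
  simp only [gradient, hx.fderiv_eq]

theorem ae_differentiableAt_of_mem_contPoly (hT : IsMesh T) {m : ℕ} {v : Pt d → ℝ}
    (hv : v ∈ contPoly T m) : ∀ᵐ x ∂(volume.restrict (domain T)), DifferentiableAt ℝ v x := by
  refine (ae_restrict_biUnion_iff _ (finite_elements hT).countable _).2 fun K hK => ?_
  obtain ⟨p, -, hp⟩ := hv.2 K hK
  filter_upwards [ae_eventuallyEq_of_eqOn_convexHull (v := v) hp] with x hx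
  exact hx.differentiableAt_iff.2 (differentiable_polyVal p x)

theorem memLp_gradient_of_mem_contPoly (hT : IsMesh T) {m : ℕ} {v : Pt d → ℝ}
    (hv : v ∈ contPoly T m) : MemLp (gradient v) 2 (volume.restrict (domain T)) := by
  refine memLp_biUnion_convexHull (finite_elements hT) fun K hK => ?_
  obtain ⟨p, -, hp⟩ := hv.2 K hK
  refine (memLp_congr_ae (gradient_ae_eq_of_eqOn_convexHull (v := v) hp)).2 ?_
  exact memLp_restrict_of_isCompact (isCompact_convexHull_finset _)
    (isCompact_convexHull_finset _).measure_lt_top (continuous_gradient_polyVal p).continuousOn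

end Mesh

/-! ### Approximation of traces by facewise constants -/

section Trace

variable {d : ℕ} {T : Geometry.SimplicialComplex ℝ (Pt d)}

/-- The oscillation of a discrete function on an element is controlled by its gradient. -/
theorem exists_oscillation_le_gradient_element (d m : ℕ) (hd : 2 ≤ d) {σ : ℝ} (hσ : 0 < σ) :
    ∃ C, 0 ≤ C ∧ ∀ (T : Geometry.SimplicialComplex ℝ (Pt d)) (h : ℝ), 0 < h → IsRegular T h σ →
      ∀ v ∈ contPoly T m, ∀ K ∈ elements T, ∀ x ∈ convexHull ℝ (K : Set (Pt d)),
      ∀ z ∈ convexHull ℝ (K : Set (Pt d)),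
      h ^ (d - 2) * (v x - v z) ^ 2 ≤
        C * ∫ y in convexHull ℝ (K : Set (Pt d)), ‖gradient v y‖ ^ 2 := by
  obtain ⟨C, hC, hosc⟩ := exists_oscillation_le_gradient_closedBall d m σ
  refine ⟨(σ * σ) ^ (d - 2) * C, by positivity, fun T h hh hT v hv K hK x hx z hz => ?_⟩
  obtain ⟨p, hp, hvp⟩ := hv.2 K hK
  obtain ⟨c, r, hr, hcr⟩ := hT.shape K hK
  have hdiam := hT.le_diam K hK
  have hhr : h ≤ σ * σ * r := by
    have := mul_le_mul_of_nonneg_left hr hσ.le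
    linarith
  -- `IsRegular` does not ask for a positive radius; positivity follows from `0 < h ≤ σ² r`.
  have hr0 : 0 < r := by
    by_contra hcon
    have := mul_nonneg (mul_pos hσ hσ).le (neg_nonneg.2 (not_lt.1 hcon))
    linarith
  -- The centre `c` belongs to the element, whose diameter is at most `σ r`.
  have hball : ∀ x ∈ convexHull ℝ (K : Set (Pt d)), x ∈ Metric.closedBall c (σ * r) := fun x hx =>
    (Metric.dist_le_diam_of_mem (isCompact_convexHull_finset K).isBounded hx
      (hcr (Metric.mem_closedBall_self hr0.le))).trans hr
  have h1 := hosc p hp c r hr0 x (hball x hx) z (hball z hz)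
  have h2 : ∫ y in Metric.closedBall c r, ‖gradient (polyVal p) y‖ ^ 2 ≤
      ∫ y in convexHull ℝ (K : Set (Pt d)), ‖gradient (polyVal p) y‖ ^ 2 :=
    setIntegral_mono_set
      (((continuous_gradient_polyVal p).norm.pow 2).continuousOn.integrableOn_compact
        (isCompact_convexHull_finset K))
      (Filter.Eventually.of_forall fun _ => sq_nonneg _) hcr.eventuallyLE
  have h3 : ∫ y in convexHull ℝ (K : Set (Pt d)), ‖gradient v y‖ ^ 2 =
      ∫ y in convexHull ℝ (K : Set (Pt d)), ‖gradient (polyVal p) y‖ ^ 2 := by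
    refine integral_congr_ae ?_
    filter_upwards [gradient_ae_eq_of_eqOn_convexHull (v := v) hvp] with y hy
    rw [hy]
  rw [hvp x hx, hvp z hz, h3]
  set J := ∫ y in convexHull ℝ (K : Set (Pt d)), ‖gradient (polyVal p) y‖ ^ 2
  set D := (polyVal p x - polyVal p z) ^ 2
  have hD : 0 ≤ D := sq_nonneg _
  have h4 : r ^ (d - 2) * D ≤ C * J := by
    have h5 : r ^ d = r ^ 2 * r ^ (d - 2) := by rw [← pow_add]; congr 1; omega
    have h6 := h1.trans (mul_le_mul_of_nonneg_left h2 (by positivity))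
    refine le_of_mul_le_mul_left (a := r ^ 2) ?_ (by positivity)
    rw [h5] at h6
    linarith
  calc h ^ (d - 2) * D ≤ (σ * σ * r) ^ (d - 2) * D :=
        mul_le_mul_of_nonneg_right (pow_le_pow_left₀ hh.le hhr _) hD
    _ = (σ * σ) ^ (d - 2) * (r ^ (d - 2) * D) := by rw [mul_pow]; ring
    _ ≤ (σ * σ) ^ (d - 2) * (C * J) := mul_le_mul_of_nonneg_left h4 (by positivity)
    _ = _ := by ring

/-- Facewise prescribed constants define, up to null sets, a function on the boundary. -/
theorem exists_facewise_constant (hd : 2 ≤ d) (hT : IsMesh T) (a : Finset (Pt d) → ℝ) :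
    ∃ c : Pt d → ℝ, ∀ F ∈ boundaryFaces T,
      ∀ᵐ x ∂((μHE[d - 1] : Measure (Pt d)).restrict (convexHull ℝ (F : Set (Pt d)))),
        c x = a F := by
  classical
  -- Where several faces meet the choice is arbitrary, but such points form a null set.
  let c : Pt d → ℝ := fun x =>
    if h : ∃ F ∈ boundaryFaces T, x ∈ convexHull ℝ (F : Set (Pt d)) then a h.choose else 0
  refine ⟨c, fun F hF => ?_⟩
  have h1 : ∀ᵐ x ∂(μHE[d - 1] : Measure (Pt d)), ∀ G ∈ boundaryFaces T, F ≠ G →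
      x ∉ convexHull ℝ (F : Set (Pt d)) ∩ convexHull ℝ (G : Set (Pt d)) := by
    rw [ae_ball_iff (finite_boundaryFaces hT).countable]
    intro G hG
    by_cases hFG : F = G
    · simp [hFG]
    · have hc1 := hF.2.1
      have hc2 := hG.2.1
      have := aedisjoint_convexHull hF.1 hG.1 (n := d - 1) (by omega) (by omega) hFG
      filter_upwards [measure_eq_zero_iff_ae_notMem.1 this] with x hx _ using hx
  rw [ae_restrict_iff' (isCompact_convexHull_finset F).measurableSet]
  filter_upwards [h1] with x hx hxF
  have h : ∃ F ∈ boundaryFaces T, x ∈ convexHull ℝ (F : Set (Pt d)) := ⟨F, hF, hxF⟩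
  have h2 : F = h.choose := by
    by_contra hne
    exact hx _ h.choose_spec.1 hne ⟨hxF, h.choose_spec.2⟩
  simp only [c, dif_pos h, ← h2]

theorem facePoly_mono {i j : ℕ} (hij : i ≤ j) : facePoly T i ≤ facePoly T j := by
  intro η hη F hF
  obtain ⟨p, hp, h⟩ := hη F hF
  exact ⟨p, hp.trans hij, h⟩

theorem setIntegral_domain_eq_sum (hT : IsMesh T) {f : Pt d → ℝ}
    (hf : IntegrableOn f (domain T)) :
    ∫ x in domain T, f x =
      ∑ K ∈ (finite_elements hT).toFinset, ∫ x in convexHull ℝ (K : Set (Pt d)), f x := by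
  rw [← EuclideanSpace.euclideanHausdorffMeasure_eq_volume] at hf ⊢
  exact setIntegral_biUnion_convexHull (finite_elements hT) (fun _ h => h.1) (fun _ h => h.2) hf

/-- Each element is the neighbour of at most `d + 1` boundary faces. -/
theorem sum_boundaryFaces_le (hT : IsMesh T) {κ : Finset (Pt d) → Finset (Pt d)}
    (hκ : ∀ F ∈ boundaryFaces T, κ F ∈ elements T ∧ F ⊆ κ F) {J : Finset (Pt d) → ℝ}
    (hJ : ∀ K, 0 ≤ J K) :
    ∑ F ∈ (finite_boundaryFaces hT).toFinset, J (κ F) ≤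
      (d + 1) * ∑ K ∈ (finite_elements hT).toFinset, J K := by
  classical
  rw [← Finset.sum_fiberwise_of_maps_to (g := κ) (t := (finite_elements hT).toFinset)
    (fun F hF => by simpa using (hκ F (by simpa using hF)).1), Finset.mul_sum]
  refine Finset.sum_le_sum fun K hK => ?_
  have h1 : ∑ F ∈ (finite_boundaryFaces hT).toFinset with κ F = K, J (κ F) =
      ∑ F ∈ (finite_boundaryFaces hT).toFinset with κ F = K, J K :=
    Finset.sum_congr rfl fun F hF => by rw [(Finset.mem_filter.1 hF).2]
  rw [h1, Finset.sum_const, nsmul_eq_mul]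
  refine mul_le_mul_of_nonneg_right ?_ (hJ K)
  have hKc : K.card = d + 1 := ((finite_elements hT).mem_toFinset.1 hK).2
  -- Such faces are `d`-element subsets of the `d + 1` vertices of `K`.
  have h2 : ((finite_boundaryFaces hT).toFinset.filter fun F => κ F = K) ⊆ K.powersetCard d := by
    intro F hF
    rw [Finset.mem_filter, Set.Finite.mem_toFinset] at hF
    exact Finset.mem_powersetCard.2 ⟨hF.2 ▸ (hκ F hF.1).2, hF.1.2.1⟩
  have h3 := Finset.card_le_card h2
  rw [Finset.card_powersetCard, hKc, Nat.choose_succ_self_right] at h3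
  exact_mod_cast h3

/-- The trace of a discrete function is approximated by facewise constants, to first order. -/
theorem exists_facewise_constant_approx (d m : ℕ) (hd : 2 ≤ d) {σ : ℝ} (hσ : 0 < σ) :
    ∃ C, 0 ≤ C ∧ ∀ (T : Geometry.SimplicialComplex ℝ (Pt d)) (h : ℝ), IsMesh T → 0 < h →
      IsRegular T h σ → ∀ v ∈ contPoly T m, ∃ c ∈ facePoly T 0,
      ∫ x, (v x - c x) ^ 2 ∂(surf T) ≤ C * h * ∫ x in domain T, ‖gradient v x‖ ^ 2 := by
  obtain ⟨C₁, hC₁, hosc⟩ := exists_oscillation_le_gradient_element d m hd hσ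
  obtain ⟨C₂, harea⟩ := exists_euclideanHausdorffMeasure_convexHull_le d (d - 1)
  refine ⟨C₂ * σ ^ (d - 1) * C₁ * (d + 1), by positivity, fun T h hT hh hreg v hv => ?_⟩
  have hne : ∀ F ∈ boundaryFaces T, F.Nonempty := fun F hF =>
    Finset.card_pos.1 (by have := hF.2.1; omega)
  choose! κ hκ using fun F (hF : F ∈ boundaryFaces T) => hF.2.2.exists
  choose! z hz using hne
  -- The constant on each face is the value of `v` at one of its vertices.
  obtain ⟨c, hc⟩ := exists_facewise_constant hd hT (fun F => v (z F))
  have hcm : c ∈ facePoly T 0 := fun F hF => ⟨MvPolynomial.C (v (z F)), by simp, by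
    filter_upwards [hc F hF] with x hx
    simp [hx, polyVal]⟩
  refine ⟨c, hcm, ?_⟩
  have hint : Integrable (fun x => (v x - c x) ^ 2) (surf T) := by
    have := (memLp_of_mem_contPoly hd hT hv).sub (memLp_of_mem_facePoly hd hT hcm)
    exact (memLp_two_iff_integrable_sq this.1).1 this
  let J : Finset (Pt d) → ℝ := fun K => ∫ y in convexHull ℝ (K : Set (Pt d)), ‖gradient v y‖ ^ 2
  have hJ : ∀ K, 0 ≤ J K := fun K => integral_nonneg fun _ => sq_nonneg _
  have hface : ∀ F ∈ boundaryFaces T,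
      ∫ x in convexHull ℝ (F : Set (Pt d)), (v x - c x) ^ 2 ∂μHE[d - 1] ≤
        C₂ * σ ^ (d - 1) * C₁ * h * J (κ F) := by
    intro F hF
    have hFK : convexHull ℝ (F : Set (Pt d)) ⊆ convexHull ℝ (κ F : Set (Pt d)) :=
      convexHull_mono (Finset.coe_subset.2 (hκ F hF).2)
    have hFc : F.card = d - 1 + 1 := by have := hF.2.1; omega
    have hmeas := harea F (σ * h).toNNReal hFc fun x hx y hy =>
      (Metric.dist_le_diam_of_mem (isCompact_convexHull_finset (κ F)).isBounded
        (hFK (subset_convexHull ℝ _ hx)) (hFK (subset_convexHull ℝ _ hy))).trans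
        ((hreg.diam_le _ (hκ F hF).1).trans (Real.le_coe_toNNReal _))
    have hreal : (μHE[d - 1] : Measure (Pt d)).real (convexHull ℝ (F : Set (Pt d))) ≤
        C₂ * (σ * h) ^ (d - 1) := by
      have := ENNReal.toReal_mono ENNReal.coe_ne_top hmeas
      rwa [ENNReal.coe_toReal, NNReal.coe_mul, NNReal.coe_pow,
        Real.coe_toNNReal _ (by positivity)] at this
    have hpt : ∀ᵐ x ∂((μHE[d - 1] : Measure (Pt d)).restrict (convexHull ℝ (F : Set (Pt d)))),
        ‖(v x - c x) ^ 2‖ ≤ C₁ * J (κ F) / h ^ (d - 2) := by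
      filter_upwards [hc F hF, ae_restrict_mem (isCompact_convexHull_finset F).measurableSet]
        with x hx hxF
      rw [Real.norm_eq_abs, abs_of_nonneg (sq_nonneg _), hx, le_div_iff₀ (by positivity), mul_comm]
      exact hosc T h hh hreg v hv (κ F) (hκ F hF).1 x (hFK hxF) (z F)
        (hFK (subset_convexHull ℝ _ (hz F hF)))
    have h1 := norm_setIntegral_le_of_norm_le_const_ae
      (euclideanHausdorffMeasure_convexHull_lt_top hFc) hpt
    refine (le_abs_self _).trans (h1.trans ?_)
    refine (mul_le_mul_of_nonneg_left hreal
      (div_nonneg (mul_nonneg hC₁ (hJ _)) (by positivity))).trans (le_of_eq ?_)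
    -- Face area of order `h ^ (d - 1)` against the oscillation weight `h ^ (d - 2)` leaves one
    -- factor `h`.
    have h2 : h ^ (d - 1) = h ^ (d - 2) * h := by rw [← pow_succ]; congr 1; omega
    rw [mul_pow, h2]
    field_simp
  have hgint : IntegrableOn (fun x => ‖gradient v x‖ ^ 2) (domain T) := by
    have := memLp_gradient_of_mem_contPoly hT hv
    exact (memLp_two_iff_integrable_sq_norm this.1).1 this
  calc ∫ x, (v x - c x) ^ 2 ∂(surf T)
      = ∑ F ∈ (finite_boundaryFaces hT).toFinset,
          ∫ x in convexHull ℝ (F : Set (Pt d)), (v x - c x) ^ 2 ∂μHE[d - 1] :=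
        setIntegral_biUnion_convexHull (finite_boundaryFaces hT) (fun _ h => h.1)
          (fun _ hF => by have := hF.2.1; omega) hint
    _ ≤ ∑ F ∈ (finite_boundaryFaces hT).toFinset, C₂ * σ ^ (d - 1) * C₁ * h * J (κ F) :=
        Finset.sum_le_sum fun F hF => hface F (by simpa using hF)
    _ = C₂ * σ ^ (d - 1) * C₁ * h * ∑ F ∈ (finite_boundaryFaces hT).toFinset, J (κ F) := by
        rw [Finset.mul_sum]
    _ ≤ C₂ * σ ^ (d - 1) * C₁ * h * ((d + 1) * ∑ K ∈ (finite_elements hT).toFinset, J K) :=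
        mul_le_mul_of_nonneg_left (sum_boundaryFaces_le hT hκ hJ) (by positivity)
    _ = _ := by rw [setIntegral_domain_eq_sum hT hgint]; ring

end Trace

/-! ### Stability of the saddle point form in inner product spaces -/

section Abstract

open scoped InnerProductSpace

theorem three_sq_le {X Y N κ S : ℝ} (hκ : 0 < κ)
    (h : κ * (X ^ 2 + Y ^ 2 + N ^ 2) ≤ S) : (X + Y + N) ^ 2 ≤ 3 / κ * S := by
  have h1 : (X + Y + N) ^ 2 ≤ 3 * (X ^ 2 + Y ^ 2 + N ^ 2) := by
    nlinarith [sq_nonneg (X - Y), sq_nonneg (X - N), sq_nonneg (Y - N)]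
  refine h1.trans ?_
  rw [div_mul_eq_mul_div, le_div_iff₀ hκ]
  linarith

set_option maxHeartbeats 1000000 in
/-- The stability estimate behind the inf-sup condition of the corrected form: `v` realises the
inf-sup condition for `η`, and `c` is a multiplier approximating the trace `y`. -/
theorem exists_stability_constants {I : ℝ} (hI : 0 < I) (C₁ R₁ : ℝ) (hC₁ : 0 ≤ C₁) :
    ∃ α β C : ℝ, 0 < C ∧ ∀ (E B : Type) [NormedAddCommGroup E] [InnerProductSpace ℝ E]
      [NormedAddCommGroup B] [InnerProductSpace ℝ B] (gy gv : E) (y v η c r : B),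
      ‖η‖ ^ 2 ≤ I * ⟪η, v⟫_ℝ → ‖gv‖ + ‖v‖ ≤ I * ‖η‖ → ‖y - c‖ ≤ C₁ * ‖gy‖ →
      -(1 / (4 * I ^ 4)) * ‖η‖ ^ 2 ≤ ⟪r, η⟫_ℝ → ‖r‖ ≤ R₁ * ‖η‖ →
      (‖gy‖ + ‖y‖ + ‖η‖) ^ 2 ≤ C * (⟪gy, gy + α • gv⟫_ℝ + ⟪η, y + α • v⟫_ℝ
        + ⟪y, -η + β • c⟫_ℝ - ⟪r, -η + β • c⟫_ℝ) ∧
      ‖gy + α • gv‖ + ‖y + α • v‖ + ‖-η + β • c‖ ≤ C * (‖gy‖ + ‖y‖ + ‖η‖) := by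
  -- With this `α`, both the gain `α / I` and `(α I)²` equal `q = I⁻⁴`, so Young's inequality for
  -- `⟪gy, gv⟫` costs only half the gain.
  set α : ℝ := 1 / I ^ 3 with hα
  have hα0 : 0 < α := by positivity
  -- Small enough for `β C₁² ≤ 1/2` and `β R₁² ≤ q/4`.
  set β : ℝ := 1 / (2 * C₁ ^ 2 + 4 * I ^ 4 * R₁ ^ 2 + 1) with hβ
  have hβ0 : 0 < β := by positivity
  have hβ1 : β * (2 * C₁ ^ 2 + 4 * I ^ 4 * R₁ ^ 2 + 1) = 1 := by rw [hβ]; field_simp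
  set q : ℝ := 1 / I ^ 4 with hq
  have hq0 : 0 < q := by positivity
  have hqI : q * I ^ 4 = 1 := by rw [hq]; field_simp
  have hβC : β * C₁ ^ 2 ≤ 1 / 2 := by
    have : 0 ≤ β * (4 * I ^ 4 * R₁ ^ 2) := by positivity
    nlinarith
  have hβR : β * R₁ ^ 2 ≤ q / 4 := by
    have h1 : 0 ≤ β * C₁ ^ 2 := by positivity
    have h2 : β * (4 * I ^ 4 * R₁ ^ 2) ≤ 1 := by nlinarith
    have h3 := mul_le_mul_of_nonneg_left h2 hq0.le
    have h4 : q * (β * (4 * I ^ 4 * R₁ ^ 2)) = 4 * (q * I ^ 4) * (β * R₁ ^ 2) := by ring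
    rw [h4, hqI] at h3
    linarith
  -- What survives absorption: `1 - 1/2 - 1/4` for `gy`, `q - q/2 - q/4 - q/8` for `η`, and `β/2`
  -- for `y`.
  set κ : ℝ := min (min (1 / 4) (q / 8)) (β / 2) with hκ
  have hκ0 : 0 < κ := by positivity
  have hκ1 : κ ≤ 1 / 4 := (min_le_left _ _).trans (min_le_left _ _)
  have hκ2 : κ ≤ q / 8 := (min_le_left _ _).trans (min_le_right _ _)
  have hκ3 : κ ≤ β / 2 := min_le_right _ _
  refine ⟨α, β, 3 / κ + (1 + 2 * (α * I) + β + β * C₁), by positivity, ?_⟩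
  intro E B _ _ _ _ gy gv y v η c r h1 h2 h3 h4 h5
  have hgv : ‖gv‖ ≤ I * ‖η‖ := by linarith [norm_nonneg v]
  have hv : ‖v‖ ≤ I * ‖η‖ := by linarith [norm_nonneg gv]
  have hX := norm_nonneg gy
  have hY := norm_nonneg y
  have hN := norm_nonneg η
  have e1 : ⟪gy, gy + α • gv⟫_ℝ ≥ ‖gy‖ ^ 2 - α * (‖gy‖ * (I * ‖η‖)) := by
    rw [inner_add_right, inner_smul_right, real_inner_self_eq_norm_sq]
    have := (abs_le.1 (abs_real_inner_le_norm gy gv)).1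
    have h7 := mul_le_mul_of_nonneg_left hgv hX
    have h8 := mul_le_mul_of_nonneg_left
      (show -(‖gy‖ * (I * ‖η‖)) ≤ ⟪gy, gv⟫_ℝ by linarith) hα0.le
    linarith
  have e2 : ⟪η, y + α • v⟫_ℝ ≥ ⟪η, y⟫_ℝ + q * ‖η‖ ^ 2 := by
    rw [inner_add_right, inner_smul_right]
    have := mul_le_mul_of_nonneg_left h1 hq0.le
    have h6 : q * (I * ⟪η, v⟫_ℝ) = α * ⟪η, v⟫_ℝ := by rw [hq, hα]; field_simp
    linarith
  -- Polarisation is used so that `β/2 * ‖c‖²` is kept; it absorbs the same term in `e6`.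
  have e3 : ⟪y, -η + β • c⟫_ℝ ≥ -⟪η, y⟫_ℝ + β / 2 * (‖y‖ ^ 2 + ‖c‖ ^ 2 - C₁ ^ 2 * ‖gy‖ ^ 2) := by
    rw [inner_add_right, inner_neg_right, inner_smul_right, real_inner_comm]
    have h6 := norm_sub_sq_real y c
    have h7 := pow_le_pow_left₀ (norm_nonneg _) h3 2
    rw [mul_pow] at h7
    have h8 := mul_le_mul_of_nonneg_left
      (show (‖y‖ ^ 2 + ‖c‖ ^ 2 - C₁ ^ 2 * ‖gy‖ ^ 2) / 2 ≤ ⟪y, c⟫_ℝ by linarith) hβ0.le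
    linarith
  have e4 : ⟪r, -η + β • c⟫_ℝ ≤ q / 4 * ‖η‖ ^ 2 + β * (R₁ * ‖η‖ * ‖c‖) := by
    rw [inner_add_right, inner_neg_right, inner_smul_right]
    have h6 := (real_inner_le_norm r c).trans (mul_le_mul_of_nonneg_right h5 (norm_nonneg c))
    have h7 := mul_le_mul_of_nonneg_left h6 hβ0.le
    have h8 : 1 / (4 * I ^ 4) = q / 4 := by rw [hq]; field_simp
    rw [h8] at h4
    linarith
  have e5 : α * (‖gy‖ * (I * ‖η‖)) ≤ ‖gy‖ ^ 2 / 2 + q / 2 * ‖η‖ ^ 2 := by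
    have h6 : (α * I) ^ 2 = q := by rw [hα, hq]; field_simp
    rw [← h6]
    nlinarith [sq_nonneg (‖gy‖ - α * I * ‖η‖)]
  have e6 : β * (R₁ * ‖η‖ * ‖c‖) ≤ β / 2 * (R₁ ^ 2 * ‖η‖ ^ 2 + ‖c‖ ^ 2) := by
    nlinarith [mul_nonneg hβ0.le (sq_nonneg (R₁ * ‖η‖ - ‖c‖))]
  have e7 : β * C₁ ^ 2 * ‖gy‖ ^ 2 ≤ 1 / 2 * ‖gy‖ ^ 2 :=
    mul_le_mul_of_nonneg_right hβC (sq_nonneg _)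
  have e8 : β * R₁ ^ 2 * ‖η‖ ^ 2 ≤ q / 4 * ‖η‖ ^ 2 :=
    mul_le_mul_of_nonneg_right hβR (sq_nonneg _)
  have e9 : κ * (‖gy‖ ^ 2 + ‖y‖ ^ 2 + ‖η‖ ^ 2) ≤ ⟪gy, gy + α • gv⟫_ℝ + ⟪η, y + α • v⟫_ℝ
        + ⟪y, -η + β • c⟫_ℝ - ⟪r, -η + β • c⟫_ℝ := by
    have f1 := mul_le_mul_of_nonneg_right hκ1 (sq_nonneg ‖gy‖)
    have f2 := mul_le_mul_of_nonneg_right hκ2 (sq_nonneg ‖η‖)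
    have f3 := mul_le_mul_of_nonneg_right hκ3 (sq_nonneg ‖y‖)
    linarith
  have hS : 0 ≤ ⟪gy, gy + α • gv⟫_ℝ + ⟪η, y + α • v⟫_ℝ
        + ⟪y, -η + β • c⟫_ℝ - ⟪r, -η + β • c⟫_ℝ := le_trans (by positivity) e9
  constructor
  · refine (three_sq_le hκ0 e9).trans (mul_le_mul_of_nonneg_right ?_ hS)
    have : 0 ≤ 1 + 2 * (α * I) + β + β * C₁ := by positivity
    linarith
  · have g1 : ‖gy + α • gv‖ ≤ ‖gy‖ + α * I * ‖η‖ := by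
      refine (norm_add_le _ _).trans ?_
      rw [norm_smul, Real.norm_eq_abs, abs_of_pos hα0]
      have := mul_le_mul_of_nonneg_left hgv hα0.le
      linarith
    have g2 : ‖y + α • v‖ ≤ ‖y‖ + α * I * ‖η‖ := by
      refine (norm_add_le _ _).trans ?_
      rw [norm_smul, Real.norm_eq_abs, abs_of_pos hα0]
      have := mul_le_mul_of_nonneg_left hv hα0.le
      linarith
    have g3 : ‖-η + β • c‖ ≤ ‖η‖ + β * ‖y‖ + β * C₁ * ‖gy‖ := by
      refine (norm_add_le _ _).trans ?_
      rw [norm_smul, norm_neg, Real.norm_eq_abs, abs_of_pos hβ0]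
      have h6 : ‖c‖ ≤ ‖y‖ + C₁ * ‖gy‖ := by
        have := norm_sub_le y (y - c)
        rw [sub_sub_cancel] at this
        linarith
      have := mul_le_mul_of_nonneg_left h6 hβ0.le
      linarith
    have i1 : 0 ≤ 3 / κ * (‖gy‖ + ‖y‖ + ‖η‖) := by positivity
    have i2 : 0 ≤ α * I * ‖gy‖ := by positivity
    have i3 : 0 ≤ α * I * ‖y‖ := by positivity
    have i4 : 0 ≤ β * ‖gy‖ := by positivity
    have i5 : 0 ≤ β * ‖η‖ := by positivity
    have i6 : 0 ≤ β * C₁ * ‖y‖ := by positivity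
    have i7 : 0 ≤ β * C₁ * ‖η‖ := by positivity
    linarith

end Abstract

/-! ### The discrete form in terms of `L²` spaces -/

section Lp

variable {α E : Type*} [MeasurableSpace α] {μ : Measure α} [NormedAddCommGroup E]
  [InnerProductSpace ℝ E]

theorem inner_toLp {f g : α → E} (hf : MemLp f 2 μ) (hg : MemLp g 2 μ) :
    inner ℝ hf.toLp hg.toLp = ∫ x, inner ℝ (f x) (g x) ∂μ := by
  rw [L2.inner_def]
  refine integral_congr_ae ?_
  filter_upwards [hf.coeFn_toLp, hg.coeFn_toLp] with x hx hx'
  rw [hx, hx']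

theorem norm_toLp_sq {f : α → E} (hf : MemLp f 2 μ) :
    ‖hf.toLp‖ ^ 2 = ∫ x, ‖f x‖ ^ 2 ∂μ := by
  rw [← real_inner_self_eq_norm_sq, inner_toLp]
  simp only [real_inner_self_eq_norm_sq]

theorem norm_toLp {f : α → E} (hf : MemLp f 2 μ) :
    ‖hf.toLp‖ = √(∫ x, ‖f x‖ ^ 2 ∂μ) := by
  rw [← norm_toLp_sq, Real.sqrt_sq (norm_nonneg _)]

theorem toLp_add_smul {f g k : α → E} (hf : MemLp f 2 μ) (hg : MemLp g 2 μ) (hk : MemLp k 2 μ)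
    (c : ℝ) (h : k =ᵐ[μ] fun x => f x + c • g x) : hk.toLp = hf.toLp + c • hg.toLp := by
  rw [← MemLp.toLp_const_smul, ← MemLp.toLp_add]
  exact (MemLp.toLp_eq_toLp_iff _ _).2 h

end Lp

section Form

variable {d : ℕ} {T : Geometry.SimplicialComplex ℝ (Pt d)}

theorem norm_toLp_gradient {v : Pt d → ℝ} (hv : MemLp (gradient v) 2 (volume.restrict (domain T))) :
    ‖hv.toLp‖ = gradNorm T v := norm_toLp hv

theorem norm_toLp_surf {f : Pt d → ℝ} (hf : MemLp f 2 (surf T)) : ‖hf.toLp‖ = bdryNorm T f := by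
  rw [norm_toLp, bdryNorm]
  simp only [Real.norm_eq_abs, sq_abs]

/-- Used with `f`, `g` carrying the weights `h^{1/2}` and `h^{-1/2}`, which cancel in the product
and give back the unweighted pairing. -/
theorem inner_toLp_surf {f g u w : Pt d → ℝ} (hf : MemLp f 2 (surf T)) (hg : MemLp g 2 (surf T))
    (h : ∀ x, f x * g x = u x * w x) : inner ℝ hf.toLp hg.toLp = bdryInner T u w := by
  rw [inner_toLp, bdryInner]
  refine integral_congr_ae (Filter.Eventually.of_forall fun x => ?_)
  simp only [RCLike.inner_apply, conj_trivial]
  rw [mul_comm, h]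

theorem gradient_add_smul_ae_eq (hT : IsMesh T) {m : ℕ} {u v : Pt d → ℝ} (hu : u ∈ contPoly T m)
    (hv : v ∈ contPoly T m) (a : ℝ) :
    gradient (u + a • v) =ᵐ[volume.restrict (domain T)] fun x => gradient u x + a • gradient v x := by
  filter_upwards [ae_differentiableAt_of_mem_contPoly hT hu,
    ae_differentiableAt_of_mem_contPoly hT hv] with x hx hx'
  rw [← gradient_const_smul a hx', ← gradient_add hx (hx'.const_mul a)]
  rfl

end Form

end BoundaryCorrection

end

/-! ### Transfer of the abstract stability estimate to the mesh -/

open BoundaryCorrection in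
theorem mainTheorem1 (d k m : ℕ) (hd : 2 ≤ d) (hk : 1 ≤ k) (σ Cis : ℝ) (hσ : 0 < σ)
    (hCis : 0 < Cis) :
    ∃ Cbd > 0, ∀ Cρ : ℝ, ∃ C > 0,
      ∀ (T : Geometry.SimplicialComplex ℝ (Pt d)) (h : ℝ), IsMesh T → 0 < h → IsRegular T h σ →
      ∀ V : Submodule ℝ (Pt d → ℝ), contPoly T k ≤ V → V ≤ contPoly T m →
      InfSup T h Cis V (facePoly T (k - 1)) →
      ∀ ρ : Pt d → ℝ, AEMeasurable ρ (surf T) →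
      (∀ᵐ x ∂(surf T), -(Cbd * h) ≤ ρ x) → (∀ᵐ x ∂(surf T), |ρ x| ≤ Cρ * h) →
      ∀ y ∈ V, ∀ η ∈ facePoly T (k - 1), ∃ v ∈ V, ∃ μ ∈ facePoly T (k - 1),
        tripleNorm T h y η ^ 2 ≤ C * formA T ρ y η v μ ∧
        tripleNorm T h v μ ≤ C * tripleNorm T h y η := by
  obtain ⟨C₁, hC₁, happrox⟩ := exists_facewise_constant_approx d m hd hσ
  -- A quarter of the gain `Cis⁻⁴` that the inf-sup function yields.
  refine ⟨1 / (4 * Cis ^ 4), by positivity, fun Cρ => ?_⟩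
  obtain ⟨α, β, C, hC, hstab⟩ :=
    exists_stability_constants hCis (√C₁) |Cρ| (Real.sqrt_nonneg _)
  refine ⟨C, hC, fun T h hT hh hreg V hkV hVm hinf ρ hρ hρ1 hρ2 y hy η hη => ?_⟩
  obtain ⟨w, hw, hw1, hw2⟩ := hinf η hη
  obtain ⟨c, hc, hyc⟩ := happrox T h hT hh hreg y (hVm hy)
  have hc' := facePoly_mono (Nat.zero_le (k - 1)) hc
  have hv' : y + α • w ∈ V := V.add_mem hy (V.smul_mem α hw)
  -- The factor `h⁻¹` turns the multiplier weight `h^{1/2}` into the trace weight `h^{-1/2}`, so `c`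
  -- is measured like `y`.
  have hμ' : -η + (β * h⁻¹) • c ∈ facePoly T (k - 1) :=
    Submodule.add_mem _ (Submodule.neg_mem _ hη) (Submodule.smul_mem _ _ hc')
  refine ⟨_, hv', _, hμ', ?_⟩
  rw [tripleNorm, tripleNorm, formA]
  set s : ℝ := h ^ (1 / 2 : ℝ) with hs
  set t : ℝ := h ^ (-(1 / 2) : ℝ) with ht
  have hs0 : 0 < s := Real.rpow_pos_of_pos hh _
  have ht0 : 0 < t := Real.rpow_pos_of_pos hh _
  have hst : s * t = 1 := by rw [hs, ht, ← Real.rpow_add hh]; norm_num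
  have hss : s * s = h := by rw [hs, ← Real.rpow_add hh]; norm_num
  have htt : t * t = h⁻¹ := by rw [ht, ← Real.rpow_add hh]; norm_num [Real.rpow_neg_one]
  have hth : t * h = s := by rw [← hss, ← mul_assoc, mul_comm t s, hst, one_mul]
  have hsh : s * h⁻¹ = t := by rw [← htt, ← mul_assoc, hst, one_mul]
  have hρη : ∀ᵐ x ∂(surf T), ‖t * (ρ x * η x)‖ ≤ |Cρ| * ‖s * η x‖ := by
    filter_upwards [hρ2] with x hx
    rw [norm_mul, norm_mul, norm_mul, Real.norm_of_nonneg ht0.le, Real.norm_of_nonneg hs0.le, ← hth,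
      Real.norm_eq_abs (ρ x)]
    have h1 : |ρ x| ≤ |Cρ| * h := hx.trans (mul_le_mul_of_nonneg_right (le_abs_self _) hh.le)
    have h2 := mul_le_mul_of_nonneg_left h1 (mul_nonneg ht0.le (norm_nonneg (η x)))
    linarith
  have gy := memLp_gradient_of_mem_contPoly hT (hVm hy)
  have gw := memLp_gradient_of_mem_contPoly hT (hVm hw)
  have gv := memLp_gradient_of_mem_contPoly hT (hVm hv')
  have my := (memLp_of_mem_contPoly hd hT (hVm hy)).const_mul t
  have mw := (memLp_of_mem_contPoly hd hT (hVm hw)).const_mul t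
  have mv := (memLp_of_mem_contPoly hd hT (hVm hv')).const_mul t
  have mη0 := memLp_of_mem_facePoly hd hT hη
  have mη := mη0.const_mul s
  have mc := (memLp_of_mem_facePoly hd hT hc).const_mul t
  have mμ := (memLp_of_mem_facePoly hd hT hμ').const_mul s
  -- The term `ρ η` is paired with a multiplier of weight `s`, so it carries `t`; then `|ρ| ≤ |Cρ|
  -- h` and `t h = s` bound it by `η` with weight `s`.
  have mr : MemLp (fun x => t * (ρ x * η x)) 2 (surf T) :=
    mη.of_le_mul ((hρ.aestronglyMeasurable.mul mη0.1).const_mul t) hρη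
  have ev : gv.toLp = gy.toLp + α • gw.toLp :=
    toLp_add_smul gy gw gv α (gradient_add_smul_ae_eq hT (hVm hy) (hVm hw) α)
  have ew : mv.toLp = my.toLp + α • mw.toLp :=
    toLp_add_smul my mw mv α (Filter.Eventually.of_forall fun x => by
      simp only [Pi.add_apply, Pi.smul_apply, smul_eq_mul]; ring)
  have eμ : mμ.toLp = -mη.toLp + β • mc.toLp := by
    rw [← MemLp.toLp_neg]
    refine toLp_add_smul mη.neg mc mμ β (Filter.Eventually.of_forall fun x => ?_)
    simp only [Pi.add_apply, Pi.smul_apply, Pi.neg_apply, smul_eq_mul, ← hsh]; ring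
  have key := hstab _ _ gy.toLp gw.toLp my.toLp mw.toLp mη.toLp mc.toLp mr.toLp ?_ ?_ ?_ ?_ ?_
  · rw [← ev, ← ew, ← eμ, inner_toLp gy gv, norm_toLp_gradient, norm_toLp_gradient,
      norm_toLp_surf, norm_toLp_surf, norm_toLp_surf, norm_toLp_surf,
      inner_toLp_surf mη mv (u := η) (w := y + α • w) (fun x => by
        linear_combination (η x * (y + α • w) x) * hst),
      inner_toLp_surf my mμ (u := y) (w := -η + (β * h⁻¹) • c) (fun x => by
        linear_combination (y x * (-η + (β * h⁻¹) • c) x) * hst),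
      inner_toLp_surf mr mμ (u := fun x => ρ x * η x) (w := -η + (β * h⁻¹) • c) (fun x => by
        linear_combination (ρ x * η x * (-η + (β * h⁻¹) • c) x) * hst)] at key
    exact key
  · rw [norm_toLp_surf, inner_toLp_surf mη mw (u := η) (w := w) (fun x => by
      linear_combination (η x * w x) * hst)]
    exact hw1
  · rw [norm_toLp_gradient, norm_toLp_surf, norm_toLp_surf]
    exact hw2
  · rw [← MemLp.toLp_sub]
    refine abs_le_of_sq_le_sq' ?_ (by positivity) |>.2
    rw [norm_toLp_sq, mul_pow, Real.sq_sqrt hC₁, norm_toLp_sq]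
    have h1 : ∀ x, ‖((fun x => t * y x) - fun x => t * c x) x‖ ^ 2 =
        t * t * (y x - c x) ^ 2 := fun x => by
      rw [Pi.sub_apply, Real.norm_eq_abs, sq_abs]; ring
    simp only [h1]
    -- The weight `t² = h⁻¹` cancels the factor `h` of the trace approximation.
    rw [integral_const_mul, htt, inv_mul_le_iff₀ hh]
    linarith
  · rw [norm_toLp_sq, inner_toLp, ← integral_const_mul]
    refine integral_mono_ae ?_ ?_ ?_
    · exact ((memLp_two_iff_integrable_sq_norm mη.1).1 mη).const_mul _
    · exact (L2.integrable_inner mr.toLp mη.toLp).congr (by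
        filter_upwards [mr.coeFn_toLp, mη.coeFn_toLp] with x hx hx'
        rw [hx, hx'])
    · filter_upwards [hρ1] with x hx
      simp only [RCLike.inner_apply, conj_trivial, Real.norm_eq_abs, sq_abs]
      have h1 : (s * η x) ^ 2 = h * η x ^ 2 := by rw [← hss]; ring
      have h2 : s * η x * (t * (ρ x * η x)) = ρ x * η x ^ 2 := by
        linear_combination (ρ x * η x ^ 2) * hst
      rw [h1, h2]
      have := mul_le_mul_of_nonneg_right hx (sq_nonneg (η x))
      linarith
  · refine Lp.norm_le_mul_norm_of_ae_le_mul ?_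
    filter_upwards [mr.coeFn_toLp, mη.coeFn_toLp, hρη] with x hx hx' hx''
    rw [hx, hx']
    exact hx''
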